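/- Let $\Theta$ be a set of atomic propositions. Let $\mathcal L_C$ be the classical propositional language over $\Theta$ built from $\neg$ and $\to$, and let $\mathcal L\supseteq\mathcal L_C$ be the language over $\Theta$ built from $\neg$, $\to$, a modality $\Box$ and a binary conditional $(\psi|\phi)$. As usual, $\phi\vee\psi$ abbreviates $\neg\phi\to\psi$, $\phi\wedge\psi$ abbreviates $\neg(\neg\phi\vee\neg\psi)$, $\phi\leftrightarrow\psi$ abbreviates $(\phi\to\psi)\wedge(\psi\to\phi)$, and $\psi\times\phi$ (logical independence) abbreviates $\Box\bigl((\psi|\phi)\leftrightarrow\psi\bigr)$. Classical logic $C$ is the Hilbert system on $\mathcal L_C$ with modus ponens and the axiom schemes - c1: $\phi\to(\psi\to\phi)$, - c2: $(\eta\to(\phi\to\psi))\to((\eta\to\phi)\to(\eta\to\psi))$, - c3: $(\neg\phi\to\neg\psi)\to((\neg\phi\to\psi)\to\phi)$; write $\vdash_C\phi$ when $\phi$ is provable in it (equivalently, when $\phi$ is a classical tautology). The logic $\mathrm{DmBL}$ is the Hilbert system on $\mathcal L$ with modus ponens, the necessitation rule (from $\vdash\phi$ infer $\vdash\Box\phi$),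 and the axiom schemes c1–c3 (for all formulas of $\mathcal L$) together with - m2: $\Box(\phi\to\psi)\to(\Box\phi\to\Box\psi)$, - m3: $\Box\phi\to\phi$, - b1: $\Box(\phi\to\psi)\to\bigl(\Box\neg\phi\vee\Box(\psi|\phi)\bigr)$, - b2: $(\psi\to\eta\,|\,\phi)\to\bigl((\psi|\phi)\to(\eta|\phi)\bigr)$, - b3: $(\psi|\phi)\to(\phi\to\psi)$, - b4: $\neg(\neg\psi|\phi)\leftrightarrow(\psi|\phi)$, - b5: $(\psi\times\phi)\leftrightarrow(\phi\times\psi)$. The logic $\mathrm{DmBL}_\ast$ is obtained from $\mathrm{DmBL}$ by replacing b5 by the two schemes - b5.weak.A: $(\psi\times\neg\phi)\leftrightarrow(\psi\times\phi)$, - b5.weak.B: $\Box(\psi\leftrightarrow\eta)\to\Box\bigl((\phi|\psi)\leftrightarrow(\phi|\eta)\bigr)$. **Non-distortion.** Let $\phi\in\mathcal L_C$ be a classical proposition. 1. If $\Box\phi\vee\Box\neg\phi$ is provable in $\mathrm{DmBL}_\ast$, then $\vdash_C\phi$ or $\vdash_C\neg\phi$. 2. If $\Box\phi\vee\Box\neg\phi$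 is provable in $\mathrm{DmBL}$, then $\vdash_C\phi$ or $\vdash_C\neg\phi$. -/

import Mathlib

namespace BayesLogic

universe u

/-- The language of classical propositional logic over the atomic propositions `Θ`,
with primitive connectives negation and implication. -/
inductive ClassicalFormula (Θ : Type u) : Type u
  | atom : Θ → ClassicalFormula Θ
  | neg : ClassicalFormula Θ → ClassicalFormula Θ
  | imp : ClassicalFormula Θ → ClassicalFormula Θ → ClassicalFormula Θ

/-- The full conditional modal language over `Θ`: negation, implication, the modality `□`
and the conditional; `cond ψ φ` is the proposition `(ψ | φ)`, "`ψ` given `φ`". -/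
inductive Formula (Θ : Type u) : Type u
  | atom : Θ → Formula Θ
  | neg : Formula Θ → Formula Θ
  | box : Formula Θ → Formula Θ
  | imp : Formula Θ → Formula Θ → Formula Θ
  | cond : Formula Θ → Formula Θ → Formula Θ

/-- The inclusion of the classical language into the full language. -/
def ClassicalFormula.toFormula {Θ : Type u} : ClassicalFormula Θ → Formula Θ
  | .atom θ => .atom θ
  | .neg φ => .neg φ.toFormula
  | .imp φ ψ => .imp φ.toFormula ψ.toFormula

namespace Formula

variable {Θ : Type u}

/-- `φ ∨ ψ` abbreviates `¬φ → ψ`. -/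
def or (φ ψ : Formula Θ) : Formula Θ := imp (neg φ) ψ

/-- `φ ∧ ψ` abbreviates `¬(¬φ ∨ ¬ψ)`. -/
def and (φ ψ : Formula Θ) : Formula Θ := neg (or (neg φ) (neg ψ))

/-- `φ ↔ ψ` abbreviates `(φ → ψ) ∧ (ψ → φ)`. -/
def iff (φ ψ : Formula Θ) : Formula Θ := and (imp φ ψ) (imp ψ φ)

/-- Logical independence: `ψ × φ` abbreviates `□((ψ | φ) ↔ ψ)`. -/
def indep (ψ φ : Formula Θ) : Formula Θ := box (iff (cond ψ φ) ψ)

end Formula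

/-- Provability `⊢_C` in the classical logic `C`, all formulas being classical. -/
inductive ProvableC {Θ : Type u} : ClassicalFormula Θ → Prop
  | c1 (φ ψ : ClassicalFormula Θ) : ProvableC (.imp φ (.imp ψ φ))
  | c2 (η φ ψ : ClassicalFormula Θ) :
      ProvableC (.imp (.imp η (.imp φ ψ)) (.imp (.imp η φ) (.imp η ψ)))
  | c3 (φ ψ : ClassicalFormula Θ) :
      ProvableC (.imp (.imp (.neg φ) (.neg ψ)) (.imp (.imp (.neg φ) ψ) φ))
  | mp {φ ψ : ClassicalFormula Θ} : ProvableC φ → ProvableC (.imp φ ψ) → ProvableC ψ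

open Formula in
/-- The axioms common to DmBL and DmBL∗: classical (`c`), modal (`m`), Bayesian (`b`). -/
inductive CommonAxiom {Θ : Type u} : Formula Θ → Prop
  | c1 (φ ψ : Formula Θ) : CommonAxiom (imp φ (imp ψ φ))
  | c2 (η φ ψ : Formula Θ) :
      CommonAxiom (imp (imp η (imp φ ψ)) (imp (imp η φ) (imp η ψ)))
  | c3 (φ ψ : Formula Θ) :
      CommonAxiom (imp (imp (neg φ) (neg ψ)) (imp (imp (neg φ) ψ) φ))
  | m2 (φ ψ : Formula Θ) : CommonAxiom (imp (box (imp φ ψ)) (imp (box φ) (box ψ)))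
  | m3 (φ : Formula Θ) : CommonAxiom (imp (box φ) φ)
  | b1 (φ ψ : Formula Θ) :
      CommonAxiom (imp (box (imp φ ψ)) (or (box (neg φ)) (box (cond ψ φ))))
  | b2 (φ ψ η : Formula Θ) :
      CommonAxiom (imp (cond (imp ψ η) φ) (imp (cond ψ φ) (cond η φ)))
  | b3 (φ ψ : Formula Θ) : CommonAxiom (imp (cond ψ φ) (imp φ ψ))
  | b4 (φ ψ : Formula Θ) : CommonAxiom (iff (neg (cond (neg ψ) φ)) (cond ψ φ))

open Formula in
/-- The axioms of DmBL: the common ones and the symmetry `b5` of independence. -/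
inductive AxiomDmBL {Θ : Type u} : Formula Θ → Prop
  | common {φ : Formula Θ} : CommonAxiom φ → AxiomDmBL φ
  | b5 (φ ψ : Formula Θ) : AxiomDmBL (iff (indep ψ φ) (indep φ ψ))

open Formula in
/-- The axioms of DmBL∗: the common ones and the two weakenings of `b5`. -/
inductive AxiomDmBLStar {Θ : Type u} : Formula Θ → Prop
  | common {φ : Formula Θ} : CommonAxiom φ → AxiomDmBLStar φ
  | b5WeakA (φ ψ : Formula Θ) : AxiomDmBLStar (iff (indep ψ (neg φ)) (indep ψ φ))
  | b5WeakB (φ ψ η : Formula Θ) :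
      AxiomDmBLStar (imp (box (iff ψ η)) (box (iff (cond φ ψ) (cond φ η))))

/-- The theorems obtained from a set of axioms by modus ponens and necessitation (rule m1). -/
inductive Derivable {Θ : Type u} (Ax : Formula Θ → Prop) : Formula Θ → Prop
  | ax {φ : Formula Θ} : Ax φ → Derivable Ax φ
  | mp {φ ψ : Formula Θ} : Derivable Ax φ → Derivable Ax (.imp φ ψ) → Derivable Ax ψ
  | nec {φ : Formula Θ} : Derivable Ax φ → Derivable Ax (.box φ)

/-- Provability in DmBL. -/
def ProvableDmBL {Θ : Type u} (φ : Formula Θ) : Prop := Derivable AxiomDmBL φ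

/-- Provability in DmBL∗. -/
def ProvableDmBLStar {Θ : Type u} (φ : Formula Θ) : Prop := Derivable AxiomDmBLStar φ

end BayesLogic

/-! Both logics are sound for models with two worlds, where `□` is truth at both worlds and
`(ψ | φ)` is the truth of `ψ` at the nearest world satisfying `φ`. In such a model two propositions
are independent exactly when one of them is decided, i.e. constant over the worlds; this criterion
is symmetric and insensitive to negation, whence `b5` and `b5.weak.A`. The two worlds can carry
arbitrary valuations of the atoms, so a classical `φ` with `□φ ∨ □¬φ` provable has the same truth
value under all valuations, and completeness of `C` gives `⊢_C φ` or `⊢_C ¬φ`. -/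

namespace BayesLogic

variable {Θ W : Type*}

theorem ProvableC.imp_self (φ : ClassicalFormula Θ) : ProvableC (.imp φ φ) :=
  .mp (.c1 φ φ) (.mp (.c1 φ (.imp φ φ)) (.c2 φ (.imp φ φ) φ))

namespace ClassicalFormula

/-- The truth of a classical formula under a valuation `V` of the atoms. -/
def Holds (V : Θ → Prop) : ClassicalFormula Θ → Prop
  | atom θ => V θ
  | neg φ => ¬ φ.Holds V
  | imp φ ψ => φ.Holds V → ψ.Holds V

/-- Derivability in the logic `C` from a set `Γ` of hypotheses. -/
inductive Entails (Γ : Set (ClassicalFormula Θ)) : ClassicalFormula Θ → Prop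
  | hyp {φ : ClassicalFormula Θ} : φ ∈ Γ → Entails Γ φ
  | thm {φ : ClassicalFormula Θ} : ProvableC φ → Entails Γ φ
  | mp {φ ψ : ClassicalFormula Θ} : Entails Γ φ → Entails Γ (imp φ ψ) → Entails Γ ψ

variable {Γ Δ : Set (ClassicalFormula Θ)} {φ ψ χ : ClassicalFormula Θ}

namespace Entails

theorem provableC (h : Entails ∅ φ) : ProvableC φ := by
  induction h with
  | hyp h => exact absurd h (Set.notMem_empty _)
  | thm h => exact h
  | mp _ _ ih₁ ih₂ => exact .mp ih₁ ih₂

theorem mono (hΓ : Γ ⊆ Δ) (h : Entails Γ φ) : Entails Δ φ := by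
  induction h with
  | hyp h => exact .hyp (hΓ h)
  | thm h => exact .thm h
  | mp _ _ ih₁ ih₂ => exact .mp ih₁ ih₂

theorem weaken (h : Entails Γ φ) : Entails (insert ψ Γ) φ :=
  h.mono (Set.subset_insert _ _)

theorem insert_self : Entails (insert φ Γ) φ :=
  .hyp (Set.mem_insert _ _)

theorem imp_of_right (h : Entails Γ φ) : Entails Γ (imp ψ φ) :=
  .mp h (.thm (.c1 _ _))

theorem deduction (h : Entails (insert ψ Γ) φ) : Entails Γ (imp ψ φ) := by
  induction h with
  | hyp h =>
    obtain rfl | h := h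
    · exact .thm (.imp_self _)
    · exact (hyp h).imp_of_right
  | thm h => exact (thm h).imp_of_right
  | mp _ _ ih₁ ih₂ => exact .mp ih₁ (.mp ih₂ (.thm (.c2 _ _ _)))

theorem by_contra (h : Entails (insert (neg φ) Γ) ψ)
    (hn : Entails (insert (neg φ) Γ) (neg ψ)) : Entails Γ φ :=
  .mp h.deduction (.mp hn.deduction (.thm (.c3 _ _)))

theorem absurd (h : Entails Γ φ) (hn : Entails Γ (neg φ)) : Entails Γ ψ :=
  by_contra h.weaken hn.weaken

theorem of_neg_neg (h : Entails Γ (neg (neg φ))) : Entails Γ φ :=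
  by_contra insert_self h.weaken

theorem neg_intro (h : Entails (insert φ Γ) ψ) (hn : Entails (insert φ Γ) (neg ψ)) :
    Entails Γ (neg φ) :=
  by_contra (.mp (of_neg_neg insert_self) h.deduction.weaken)
    (.mp (of_neg_neg insert_self) hn.deduction.weaken)

theorem contrapose (h : Entails (insert ψ Γ) φ) : Entails (insert (neg φ) Γ) (neg ψ) :=
  neg_intro (.mp insert_self h.deduction.weaken.weaken) insert_self.weaken

theorem by_cases (h : Entails (insert ψ Γ) φ) (hn : Entails (insert (neg ψ) Γ) φ) :
    Entails Γ φ :=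
  by_contra h.contrapose hn.contrapose

theorem exists_mem_of_sUnion {c : Set (Set (ClassicalFormula Θ))} (hc : DirectedOn (· ⊆ ·) c)
    (hne : c.Nonempty) (h : Entails (⋃₀ c) φ) : ∃ Γ ∈ c, Entails Γ φ := by
  induction h with
  | hyp h =>
    obtain ⟨Γ, hΓ, h⟩ := h
    exact ⟨Γ, hΓ, .hyp h⟩
  | thm h =>
    obtain ⟨Γ, hΓ⟩ := hne
    exact ⟨Γ, hΓ, .thm h⟩
  | mp _ _ ih₁ ih₂ =>
    obtain ⟨Γ₁, hΓ₁, h₁⟩ := ih₁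
    obtain ⟨Γ₂, hΓ₂, h₂⟩ := ih₂
    obtain ⟨Γ, hΓ, hle₁, hle₂⟩ := hc Γ₁ hΓ₁ Γ₂ hΓ₂
    exact ⟨Γ, hΓ, .mp (h₁.mono hle₁) (h₂.mono hle₂)⟩

end Entails

/-- `Γ` is maximal among the sets of hypotheses from which `φ` is not derivable. Such sets are the
truth sets of the valuations that refute `φ`. -/
def IsMaximalNonEntailing (φ : ClassicalFormula Θ) (Γ : Set (ClassicalFormula Θ)) : Prop :=
  Maximal (fun Δ => ¬ Entails Δ φ) Γ

theorem exists_isMaximalNonEntailing_superset (h : ¬ Entails Γ φ) :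
    ∃ Δ, Γ ⊆ Δ ∧ IsMaximalNonEntailing φ Δ := by
  refine zorn_subset_nonempty {Δ | ¬ Entails Δ φ} (fun c hc hchain hne => ?_) Γ h
  refine ⟨⋃₀ c, fun hφ => ?_, fun _ => Set.subset_sUnion_of_mem⟩
  obtain ⟨Δ, hΔ, hΔφ⟩ := hφ.exists_mem_of_sUnion hchain.directedOn hne
  exact hc hΔ hΔφ

namespace IsMaximalNonEntailing

theorem entails_insert (hΓ : IsMaximalNonEntailing φ Γ) (h : ψ ∉ Γ) :
    Entails (insert ψ Γ) φ := by
  by_contra hn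
  exact h (hΓ.le_of_ge hn (Set.subset_insert _ _) (Set.mem_insert _ _))

theorem mem_of_entails (hΓ : IsMaximalNonEntailing φ Γ) (h : Entails Γ ψ) : ψ ∈ Γ := by
  by_contra hn
  exact hΓ.prop (.mp h (hΓ.entails_insert hn).deduction)

theorem neg_mem_iff (hΓ : IsMaximalNonEntailing φ Γ) : neg ψ ∈ Γ ↔ ψ ∉ Γ := by
  refine ⟨fun hn h => hΓ.prop (.absurd (.hyp h) (.hyp hn)), fun h => ?_⟩
  by_contra hn
  exact hΓ.prop (.by_cases (hΓ.entails_insert h) (hΓ.entails_insert hn))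

theorem imp_mem_iff (hΓ : IsMaximalNonEntailing φ Γ) : imp ψ χ ∈ Γ ↔ (ψ ∈ Γ → χ ∈ Γ) := by
  refine ⟨fun h hψ => hΓ.mem_of_entails (.mp (.hyp hψ) (.hyp h)), fun h => hΓ.mem_of_entails ?_⟩
  by_cases hψ : ψ ∈ Γ
  · exact (Entails.hyp (h hψ)).imp_of_right
  · exact (Entails.absurd .insert_self (Entails.hyp (hΓ.neg_mem_iff.2 hψ)).weaken).deduction

theorem holds_iff_mem (hΓ : IsMaximalNonEntailing φ Γ) :
    ψ.Holds (fun θ => atom θ ∈ Γ) ↔ ψ ∈ Γ := by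
  induction ψ with
  | atom θ => rfl
  | neg ψ ih => rw [Holds, ih, hΓ.neg_mem_iff]
  | imp ψ χ ihψ ihχ => rw [Holds, ihψ, ihχ, hΓ.imp_mem_iff]

end IsMaximalNonEntailing

theorem entails_of_forall_holds (h : ∀ V : Θ → Prop, (∀ ψ ∈ Γ, ψ.Holds V) → φ.Holds V) :
    Entails Γ φ := by
  by_contra hn
  obtain ⟨Δ, hΓΔ, hΔ⟩ := exists_isMaximalNonEntailing_superset hn
  exact hΔ.prop (.hyp (hΔ.holds_iff_mem.1 (h _ fun _ hψ => hΔ.holds_iff_mem.2 (hΓΔ hψ))))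

theorem provableC_of_forall_holds (h : ∀ V : Θ → Prop, φ.Holds V) : ProvableC φ :=
  (entails_of_forall_holds fun V _ => h V).provableC

end ClassicalFormula

/-- A model of the conditional modal language on the set of worlds `W`: a valuation of the atoms at
each world, and a Stalnaker selection function, for which `select A w` is the world of `A` nearest
to `w`. By convention it is `w` itself when `A` is empty. -/
structure SelectionModel (Θ W : Type*) where
  val : W → Θ → Prop
  select : Set W → W → W
  select_mem {A : Set W} (hA : A.Nonempty) (w : W) : select A w ∈ A
  select_of_mem {A : Set W} {w : W} (hw : w ∈ A) : select A w = w
  select_empty (w : W) : select ∅ w = w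

namespace SelectionModel

open Formula

open Classical in
/-- A selection model with prescribed valuations; a world outside a nonempty set `A` selects an
arbitrary element of `A`. -/
noncomputable def ofVal (V : W → Θ → Prop) : SelectionModel Θ W where
  val := V
  select A w := if h : w ∉ A ∧ A.Nonempty then h.2.some else w
  select_mem {A} hA w := by
    by_cases hw : w ∈ A
    · simp [hw]
    · simpa [hw, hA] using hA.some_mem
  select_of_mem hw := by simp [hw]
  select_empty w := by simp

/-- Truth of a formula at a world: `□` quantifies over all worlds, and `(ψ | φ)` is the truth of
`ψ` at the world selected by `φ`. -/
def Sat (M : SelectionModel Θ W) : Formula Θ → W → Prop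
  | .atom θ, w => M.val w θ
  | .neg φ, w => ¬ M.Sat φ w
  | .box φ, _ => ∀ v, M.Sat φ v
  | .imp φ ψ, w => M.Sat φ w → M.Sat ψ w
  | .cond ψ φ, w => M.Sat ψ (M.select {v | M.Sat φ v} w)

/-- Truth at all worlds of the model. -/
def Valid (M : SelectionModel Θ W) (φ : Formula Θ) : Prop := ∀ w, M.Sat φ w

/-- The formula is constant over the worlds of the model: true everywhere or false everywhere. -/
def Decides (M : SelectionModel Θ W) (φ : Formula Θ) : Prop := M.Valid φ ∨ M.Valid φ.neg

variable {M : SelectionModel Θ W} {φ ψ : Formula Θ} {v w : W}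

theorem sat_or : M.Sat (φ.or ψ) w ↔ M.Sat φ w ∨ M.Sat ψ w :=
  or_iff_not_imp_left.symm

theorem sat_and : M.Sat (φ.and ψ) w ↔ M.Sat φ w ∧ M.Sat ψ w := by
  simp only [Formula.and, Sat, sat_or, not_or, not_not]

theorem sat_iff : M.Sat (φ.iff ψ) w ↔ (M.Sat φ w ↔ M.Sat ψ w) := by
  simp only [Formula.iff, sat_and, Sat, iff_iff_implies_and_implies]

theorem sat_indep :
    M.Sat (indep ψ φ) w ↔ ∀ v, M.Sat ψ (M.select {u | M.Sat φ u} v) ↔ M.Sat ψ v := by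
  simp only [indep, Sat, sat_iff]

theorem sat_toFormula (M : SelectionModel Θ W) (φ : ClassicalFormula Θ) (w : W) :
    M.Sat φ.toFormula w ↔ φ.Holds (M.val w) := by
  induction φ with
  | atom θ => rfl
  | neg φ ih => exact not_congr ih
  | imp φ ψ ihφ ihψ => exact imp_congr ihφ ihψ

theorem decides_neg : M.Decides φ.neg ↔ M.Decides φ := by
  simp only [Decides, Valid, Sat, not_not, or_comm]

theorem Decides.sat_iff_sat (h : M.Decides φ) : M.Sat φ v ↔ M.Sat φ w :=
  h.elim (fun h => iff_of_true (h v) (h w)) (fun h => iff_of_false (h v) (h w))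

theorem decides_of_forall_sat_iff (h : ∀ w, M.Sat φ v ↔ M.Sat φ w) : M.Decides φ :=
  (em (M.Sat φ v)).imp (fun hv w => (h w).1 hv) (fun hv w => (h w).not.1 hv)

theorem Decides.select_eq (h : M.Decides φ) (w : W) : M.select {v | M.Sat φ v} w = w := by
  obtain hφ | hφ := h
  · exact M.select_of_mem (hφ w)
  · rw [Set.eq_empty_of_forall_notMem (s := {v | M.Sat φ v}) hφ, M.select_empty]

theorem sat_indep_of_decides (h : M.Decides ψ ∨ M.Decides φ) : M.Sat (indep ψ φ) w :=
  sat_indep.2 fun v => h.elim (fun hψ => hψ.sat_iff_sat) (fun hφ => by rw [hφ.select_eq])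

theorem decides_of_sat_indep (hφ : ∃! v, M.Sat φ v) (h : M.Sat (indep ψ φ) w) :
    M.Decides ψ := by
  obtain ⟨u, hu, huniq⟩ := hφ
  have select_eq (v : W) : M.select {v | M.Sat φ v} v = u := huniq _ (M.select_mem ⟨u, hu⟩ v)
  exact decides_of_forall_sat_iff fun v => select_eq v ▸ sat_indep.1 h v

theorem existsUnique_sat_of_not_decides {M : SelectionModel Θ Bool} (h : ¬ M.Decides φ) :
    ∃! w, M.Sat φ w := by
  simp only [Decides, Valid, Sat, not_or, not_forall, not_not] at h
  obtain ⟨⟨v, hv⟩, w, hw⟩ := h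
  refine ⟨w, hw, fun u hu => ?_⟩
  have hwv : w ≠ v := fun e => hv (e ▸ hw)
  have huv : u ≠ v := fun e => hv (e ▸ hu)
  rw [Bool.eq_not_of_ne hwv, Bool.eq_not_of_ne huv]

theorem sat_indep_iff_decides {M : SelectionModel Θ Bool} {w : Bool} :
    M.Sat (indep ψ φ) w ↔ M.Decides ψ ∨ M.Decides φ :=
  ⟨fun h => or_iff_not_imp_right.2 fun hφ =>
    decides_of_sat_indep (existsUnique_sat_of_not_decides hφ) h, sat_indep_of_decides⟩

theorem valid_of_commonAxiom (h : CommonAxiom φ) : M.Valid φ := by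
  intro w
  cases h with
  | c1 φ ψ => exact fun hφ _ => hφ
  | c2 η φ ψ => exact fun h h' hη => h hη (h' hη)
  | c3 φ ψ => exact fun hn h => not_not.1 fun hφ => hn hφ (h hφ)
  | m2 φ ψ => exact fun h hφ v => h v (hφ v)
  | m3 φ => exact fun h => h w
  | b1 φ ψ =>
    intro h
    rw [sat_or, or_iff_not_imp_left]
    intro hφ v
    obtain ⟨u, hu⟩ : ∃ u, M.Sat φ u := by simpa only [Sat, not_forall, not_not] using hφ
    exact h _ (M.select_mem ⟨u, hu⟩ v)
  | b2 φ ψ η => exact id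
  | b3 φ ψ => exact fun h hφ => M.select_of_mem (A := {v | M.Sat φ v}) hφ ▸ h
  | b4 φ ψ => exact sat_iff.2 not_not

theorem valid_of_axiomDmBL {M : SelectionModel Θ Bool} (h : AxiomDmBL φ) : M.Valid φ := by
  cases h with
  | common h => exact valid_of_commonAxiom h
  | b5 φ ψ =>
    intro w
    rw [sat_iff, sat_indep_iff_decides, sat_indep_iff_decides, or_comm]

theorem valid_of_axiomDmBLStar {M : SelectionModel Θ Bool} (h : AxiomDmBLStar φ) :
    M.Valid φ := by
  cases h with
  | common h => exact valid_of_commonAxiom h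
  | b5WeakA φ ψ =>
    intro w
    rw [sat_iff, sat_indep_iff_decides, sat_indep_iff_decides, decides_neg]
  | b5WeakB φ ψ η =>
    intro w h v
    have truthSet_eq : {u | M.Sat ψ u} = {u | M.Sat η u} := Set.ext fun u => sat_iff.1 (h u)
    rw [sat_iff, Sat, Sat, truthSet_eq]

theorem valid_of_derivable {Ax : Formula Θ → Prop} (hAx : ∀ φ, Ax φ → M.Valid φ)
    (h : Derivable Ax φ) : M.Valid φ := by
  induction h with
  | ax h => exact hAx _ h
  | mp _ _ ih₁ ih₂ => exact fun w => ih₂ w (ih₁ w)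
  | nec _ ih => exact fun _ => ih

theorem decides_of_valid_box_or_box_neg [Nonempty W] (h : M.Valid (.or (.box φ) (.box φ.neg))) :
    M.Decides φ :=
  sat_or.1 (h (Classical.arbitrary W))

end SelectionModel

open SelectionModel in
theorem provableC_or_provableC_neg_of_derivable {Ax : Formula Θ → Prop}
    (hAx : ∀ (M : SelectionModel Θ Bool) (ψ : Formula Θ), Ax ψ → M.Valid ψ)
    {φ : ClassicalFormula Θ}
    (h : Derivable Ax (.or (.box φ.toFormula) (.box (.neg φ.toFormula)))) :
    ProvableC φ ∨ ProvableC (.neg φ) := by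
  have holds_iff_holds (V₁ V₂ : Θ → Prop) : φ.Holds V₁ ↔ φ.Holds V₂ := by
    let M : SelectionModel Θ Bool := ofVal fun w => bif w then V₁ else V₂
    have hM : M.Decides φ.toFormula :=
      decides_of_valid_box_or_box_neg (valid_of_derivable (hAx M) h)
    calc φ.Holds V₁ ↔ M.Sat φ.toFormula true := (M.sat_toFormula φ true).symm
      _ ↔ M.Sat φ.toFormula false := hM.sat_iff_sat
      _ ↔ φ.Holds V₂ := M.sat_toFormula φ false
  by_cases hφ : ∃ V, φ.Holds V
  · obtain ⟨V, hV⟩ := hφ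
    exact .inl (ClassicalFormula.provableC_of_forall_holds fun V' => (holds_iff_holds V V').1 hV)
  · exact .inr (ClassicalFormula.provableC_of_forall_holds (not_exists.1 hφ))

end BayesLogic

theorem mainTheorem5 {Θ : Type*} (φ : BayesLogic.ClassicalFormula Θ) :
    (BayesLogic.ProvableDmBLStar
        (.or (.box φ.toFormula) (.box (.neg φ.toFormula))) →
      BayesLogic.ProvableC φ ∨ BayesLogic.ProvableC (.neg φ)) ∧
    (BayesLogic.ProvableDmBL
        (.or (.box φ.toFormula) (.box (.neg φ.toFormula))) →
      BayesLogic.ProvableC φ ∨ BayesLogic.ProvableC (.neg φ)) :=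
  ⟨BayesLogic.provableC_or_provableC_neg_of_derivable
      fun _ _ => BayesLogic.SelectionModel.valid_of_axiomDmBLStar,
    BayesLogic.provableC_or_provableC_neg_of_derivable
      fun _ _ => BayesLogic.SelectionModel.valid_of_axiomDmBL⟩
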